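/- Let $R$ be an associative unital ring. A torsion theory for right $R$-modules is a pair $\tau=(\mathcal T,\mathcal F)$ of classes of right $R$-modules that are maximal with the property that $\operatorname{Hom}_R(T,F)=0$ for all $T\in\mathcal T$, $F\in\mathcal F$; it is hereditary if $\mathcal T$ is closed under submodules. Let $\tau$ be a hereditary torsion theory with Gabriel filter $\mathfrak F=\{I \text{ a right ideal of } R : R/I\in\mathcal T\}$. For a right $R$-module $M$ let $\mathcal T(M)$ be the largest torsion submodule of $M$, let the module of quotients $M_{\mathfrak F}$ be the largest submodule $N$ of the injective envelope $E(M/\mathcal T(M))$ that contains $M/\mathcal T(M)$ and for which $N/(M/\mathcal T(M))$ is torsion, and let $q_M:M\to M_{\mathfrak F}$ be the composite $M\to M/\mathcal T(M)\hookrightarrow M_{\mathfrak F}$. Let $\Delta=\{\delta_n\}_{n\ge 0}$ be a higher derivation on $R$, that is, a family of additive maps $\delta_n:R\to R$ with $\delta_0=\mathrm{id}_R$ and $\delta_n(rs)=\sum_{i=0}^n\delta_i(r)\delta_{n-i}(s)$ for all $n\ge 0$ and $r,s\in R$. A $\Delta$-higher derivation on a right $R$-module $M$ is a family $\{d_n\}_{n\ge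 0}$ of additive maps $d_n:M\to M$ with $d_0=\mathrm{id}_M$ and $d_n(mr)=\sum_{i=0}^n d_i(m)\delta_{n-i}(r)$ for all $n\ge 0$, $m\in M$, $r\in R$. Then for every right $R$-module $M$ and every $\Delta$-higher derivation $\{d_n\}$ on $M$ there is exactly one $\Delta$-higher derivation $\{d_n'\}$ on $M_{\mathfrak F}$ such that $d_n' q_M=q_M d_n$ for all $n\ge 0$. -/

import Mathlib

open scoped RightActions

universe u

/-! A right `R`-module is a `Module Rᵐᵒᵖ M`, and a right ideal of `R` is an `Ideal Rᵐᵒᵖ`. The notions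
of torsion theory are written for (left) modules over a ring `A` and are used with `A = Rᵐᵒᵖ`. -/

/-! ### Torsion theories -/

/-- A torsion theory: a pair of classes of modules, the torsion and the torsion-free modules, which
are maximal with the property that `Hom(T, F) = 0` for all torsion `T` and torsion-free `F`. -/
structure TorsionTheory (A : Type u) [Ring A] where
  IsTorsion : ∀ (M : Type u) [AddCommGroup M] [Module A M], Prop
  IsTorsionFree : ∀ (M : Type u) [AddCommGroup M] [Module A M], Prop
  isTorsion_iff : ∀ (M : Type u) [AddCommGroup M] [Module A M],
    IsTorsion M ↔ ∀ (N : Type u) [AddCommGroup N] [Module A N],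
      IsTorsionFree N → ∀ f : M →ₗ[A] N, f = 0
  isTorsionFree_iff : ∀ (N : Type u) [AddCommGroup N] [Module A N],
    IsTorsionFree N ↔ ∀ (M : Type u) [AddCommGroup M] [Module A M],
      IsTorsion M → ∀ f : M →ₗ[A] N, f = 0

namespace TorsionTheory

variable {A : Type u} [Ring A] (τ : TorsionTheory A)

/-- A torsion theory is hereditary if submodules of torsion modules are torsion. -/
def IsHereditary : Prop :=
  ∀ (M : Type u) [AddCommGroup M] [Module A M], τ.IsTorsion M →
    ∀ N : Submodule A M, τ.IsTorsion N

variable {τ}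

lemma IsTorsion.of_surjective {M N : Type u} [AddCommGroup M] [Module A M] [AddCommGroup N]
    [Module A N] (h : τ.IsTorsion M) (f : M →ₗ[A] N) (hf : Function.Surjective f) :
    τ.IsTorsion N := by
  rw [τ.isTorsion_iff] at h ⊢
  intro Y _ _ hY g
  ext x
  obtain ⟨y, rfl⟩ := hf x
  exact LinearMap.congr_fun (h Y hY (g ∘ₗ f)) y

lemma IsHereditary.of_injective (hτ : τ.IsHereditary) {M N : Type u} [AddCommGroup M] [Module A M]
    [AddCommGroup N] [Module A N] (h : τ.IsTorsion N) (f : M →ₗ[A] N)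
    (hf : Function.Injective f) : τ.IsTorsion M :=
  (hτ N h (LinearMap.range f)).of_surjective (LinearEquiv.ofInjective f hf).symm.toLinearMap
    (LinearEquiv.ofInjective f hf).symm.surjective

lemma isTorsion_quotient_mono {I J : Ideal A} (h : τ.IsTorsion (A ⧸ I)) (hIJ : I ≤ J) :
    τ.IsTorsion (A ⧸ J) :=
  h.of_surjective (Submodule.factor hIJ) (Submodule.factor_surjective hIJ)

/-- A module is torsion if each of its elements is annihilated by some `I` with `A ⧸ I` torsion. -/
lemma isTorsion_of_forall {M : Type u} [AddCommGroup M] [Module A M]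
    (h : ∀ m : M, ∃ I : Ideal A, τ.IsTorsion (A ⧸ I) ∧ ∀ a ∈ I, a • m = 0) : τ.IsTorsion M := by
  rw [τ.isTorsion_iff]
  intro Y _ _ hY f
  ext m
  obtain ⟨I, hI, hm⟩ := h m
  have hle : I ≤ LinearMap.ker (LinearMap.toSpanSingleton A M m) := fun a ha => by
    simpa using hm a ha
  have h0 := (τ.isTorsion_iff _).1 hI Y hY (f ∘ₗ Submodule.liftQ I _ hle)
  have h1 := LinearMap.congr_fun h0 (Submodule.Quotient.mk 1)
  simpa [Submodule.liftQ_apply] using h1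

lemma isTorsion_quotient_of_colon {I J : Ideal A} (hJ : τ.IsTorsion (A ⧸ J))
    (h : ∀ x ∈ J, τ.IsTorsion (A ⧸ I.colon {x})) : τ.IsTorsion (A ⧸ I) := by
  rw [τ.isTorsion_iff]
  intro Y _ _ hY f
  have key : ∀ x ∈ J, f (Submodule.Quotient.mk x) = 0 := by
    intro x hx
    have hle : I.colon {x} ≤
        LinearMap.ker (LinearMap.toSpanSingleton A (A ⧸ I) (Submodule.Quotient.mk x)) := by
      intro a ha
      rw [Submodule.mem_colon_singleton] at ha
      rw [LinearMap.mem_ker, LinearMap.toSpanSingleton_apply, ← Submodule.Quotient.mk_smul]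
      exact (Submodule.Quotient.mk_eq_zero I).2 ha
    have h0 := (τ.isTorsion_iff _).1 (h x hx) Y hY (f ∘ₗ Submodule.liftQ _ _ hle)
    have h1 := LinearMap.congr_fun h0 (Submodule.Quotient.mk 1)
    simpa [Submodule.liftQ_apply] using h1
  have hle : J ≤ LinearMap.ker (f ∘ₗ I.mkQ) := fun x hx => by
    simpa using key x hx
  have h0 := (τ.isTorsion_iff _).1 hJ Y hY (Submodule.liftQ _ _ hle)
  refine Submodule.linearMap_qext _ (LinearMap.ext fun x => ?_)
  simpa using LinearMap.congr_fun h0 (Submodule.Quotient.mk x)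

lemma IsHereditary.isTorsion_quotient_colon (hτ : τ.IsHereditary) {I : Ideal A}
    (h : τ.IsTorsion (A ⧸ I)) (a : A) : τ.IsTorsion (A ⧸ I.colon {a}) := by
  have hle : I.colon {a} =
      LinearMap.ker (LinearMap.toSpanSingleton A (A ⧸ I) (Submodule.Quotient.mk a)) := by
    ext b
    rw [Submodule.mem_colon_singleton, LinearMap.mem_ker, LinearMap.toSpanSingleton_apply,
      ← Submodule.Quotient.mk_smul]
    exact (Submodule.Quotient.mk_eq_zero I).symm
  refine hτ.of_injective h (Submodule.liftQ _ _ hle.le) ?_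
  rw [← LinearMap.ker_eq_bot]
  exact Submodule.ker_liftQ_eq_bot _ _ _ hle.ge

/-- The filter of a hereditary torsion theory: all `I` such that `A ⧸ I` is torsion. -/
def gabrielFilter (τ : TorsionTheory A) (hτ : τ.IsHereditary) : IdealFilter A :=
  Order.IsPFilter.toPFilter (F := {I : Ideal A | τ.IsTorsion (A ⧸ I)}) <| by
    refine Order.IsPFilter.of_def ⟨⊤, ?_⟩ ?_ ?_
    · refine (τ.isTorsion_iff _).2 fun Y _ _ _ f => LinearMap.ext fun x => ?_
      rw [Subsingleton.elim x 0, map_zero, map_zero]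
    · intro I hI J hJ
      refine ⟨I ⊓ J, ?_, inf_le_left, inf_le_right⟩
      refine isTorsion_quotient_of_colon hI fun x hx => ?_
      refine isTorsion_quotient_mono (hτ.isTorsion_quotient_colon hJ x) fun a ha => ?_
      rw [Submodule.mem_colon_singleton] at ha ⊢
      exact ⟨I.smul_mem a hx, ha⟩
    · intro I J hIJ hI
      exact isTorsion_quotient_mono hI hIJ

lemma mem_gabrielFilter (hτ : τ.IsHereditary) {I : Ideal A} :
    I ∈ τ.gabrielFilter hτ ↔ τ.IsTorsion (A ⧸ I) := Iff.rfl

instance isGabriel_gabrielFilter (hτ : τ.IsHereditary) : (τ.gabrielFilter hτ).IsGabriel where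
  colon_mem hI a := hτ.isTorsion_quotient_colon hI a
  gabriel_closed I h := by
    obtain ⟨J, hJ, h⟩ := h
    exact isTorsion_quotient_of_colon hJ h

/-- Torsion with respect to `τ` is torsion with respect to the filter of `τ`. -/
theorem isTorsion_gabrielFilter_iff (hτ : τ.IsHereditary) (M : Type u) [AddCommGroup M]
    [Module A M] : (τ.gabrielFilter hτ).IsTorsion M ↔ τ.IsTorsion M := by
  refine ⟨fun h => isTorsion_of_forall h, fun h m => ?_⟩
  refine ⟨LinearMap.ker (LinearMap.toSpanSingleton A M m), ?_, fun a ha => by simpa using ha⟩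
  refine hτ.of_injective h (Submodule.liftQ _ (LinearMap.toSpanSingleton A M m) le_rfl) ?_
  rw [← LinearMap.ker_eq_bot]
  exact Submodule.ker_liftQ_eq_bot _ _ _ le_rfl

end TorsionTheory

/-! ### Injective envelopes -/

section InjectiveEnvelope

variable {A : Type u} [Ring A]

/-- `i : X → E` is an injective envelope: `E` is an injective module and `i` is an essential
monomorphism. -/
structure IsInjectiveEnvelope {X E : Type u} [AddCommGroup X] [Module A X] [AddCommGroup E]
    [Module A E] (i : X →ₗ[A] E) : Prop where
  injective_module : Module.Injective A E
  injective : Function.Injective i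
  essential : ∀ K : Submodule A E, K ⊓ LinearMap.range i = ⊥ → K = ⊥

/-- Among the submodules that meet `N` trivially there is a maximal one. -/
lemma exists_maximal_disjoint_submodule {J : Type u} [AddCommGroup J] [Module A J]
    (N : Submodule A J) : ∃ C : Submodule A J, Maximal (fun C => Disjoint C N) C := by
  obtain ⟨C, -, hC⟩ := zorn_le_nonempty₀ {C : Submodule A J | Disjoint C N} (fun c hc hchain y hy =>
    ⟨sSup c, by
      have := (hchain.directedOn.disjoint_sSup_left (a := N)).2 fun b hb => hc hb
      exact this, fun z hz => le_sSup hz⟩) ⊥ disjoint_bot_left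
  exact ⟨C, hC⟩

/-- A submodule `P` has a maximal essential extension in `J`. -/
lemma exists_maximal_essential_submodule {J : Type u} [AddCommGroup J] [Module A J]
    (P : Submodule A J) : ∃ N : Submodule A J,
      Maximal (fun N => P ≤ N ∧ ∀ K ≤ N, K ⊓ P = ⊥ → K = ⊥) N := by
  obtain ⟨N, -, hN⟩ := zorn_le_nonempty₀
    {N : Submodule A J | P ≤ N ∧ ∀ K ≤ N, K ⊓ P = ⊥ → K = ⊥} (fun c hc hchain y hy =>
    ⟨sSup c, ⟨(hc hy).1.trans (le_sSup hy), fun K hK hKP => by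
      rw [eq_bot_iff]
      intro x hx
      obtain ⟨N, hN, hxN⟩ :=
        (Submodule.mem_sSup_of_directed ⟨y, hy⟩ hchain.directedOn).1 (hK hx)
      have hspan : Submodule.span A {x} = ⊥ := by
        refine (hc hN).2 _ (by simpa using hxN) (eq_bot_iff.2 ?_)
        rw [← hKP]
        exact inf_le_inf_right _ (by simpa using hx)
      simpa using hspan⟩, fun z hz => le_sSup hz⟩) P
    ⟨le_rfl, fun K hK hKP => by rwa [inf_eq_left.2 hK] at hKP⟩
  exact ⟨N, hN⟩

/-- Every module has an injective envelope. -/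
theorem exists_isInjectiveEnvelope (X : Type u) [AddCommGroup X] [Module A X] :
    ∃ (E : ModuleCat.{u} A) (i : X →ₗ[A] E), IsInjectiveEnvelope i := by
  let J : ModuleCat.{u} A := CategoryTheory.Injective.under (ModuleCat.of A X)
  let f : X →ₗ[A] J := (CategoryTheory.Injective.ι (ModuleCat.of A X)).hom
  have hf : Function.Injective f :=
    (ModuleCat.mono_iff_injective (CategoryTheory.Injective.ι (ModuleCat.of A X))).1 inferInstance
  have hJ : Module.Injective A J :=
    Module.injective_module_of_injective_object A J
      (inj := inferInstanceAs (CategoryTheory.Injective J))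
  obtain ⟨N, hN⟩ := exists_maximal_essential_submodule (LinearMap.range f)
  obtain ⟨C, hC⟩ := exists_maximal_disjoint_submodule N
  have hker : LinearMap.ker (C.mkQ ∘ₗ N.subtype) = ⊥ := by
    rw [LinearMap.ker_comp, Submodule.ker_mkQ, ← Submodule.disjoint_iff_comap_eq_bot]
    exact hC.prop.symm
  obtain ⟨g, hg⟩ := hJ.out (C.mkQ ∘ₗ N.subtype) (LinearMap.ker_eq_bot.1 hker) N.subtype
  have hgN : ∀ x ∈ N, g (C.mkQ x) = x := fun x hx => hg ⟨x, hx⟩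
  have hgr : LinearMap.range g ≤ N := by
    refine hN.le_of_ge ⟨?_, ?_⟩ ?_
    · exact hN.prop.1.trans fun x hx => ⟨_, hgN x hx⟩
    · intro K hK hKP
      have hKN : K ⊓ N = ⊥ := hN.prop.2 _ inf_le_right (by
        rw [inf_assoc, inf_eq_right.2 hN.prop.1, hKP])
      have h1 : Disjoint (K.comap (g ∘ₗ C.mkQ)) N := by
        rw [Submodule.disjoint_def]
        intro x hx hxN
        have hxK : g (C.mkQ x) ∈ K := hx
        rw [hgN x hxN] at hxK
        have : x ∈ K ⊓ N := ⟨hxK, hxN⟩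
        simpa [hKN] using this
      have h2 : C ≤ K.comap (g ∘ₗ C.mkQ) := fun x hx => by
        have : C.mkQ x = 0 := by simpa using hx
        rw [Submodule.mem_comap, LinearMap.comp_apply, this, map_zero]
        exact K.zero_mem
      rw [eq_bot_iff]
      intro y hy
      obtain ⟨z, rfl⟩ := hK hy
      obtain ⟨x, rfl⟩ := C.mkQ_surjective z
      have hx : C.mkQ x = 0 := by simpa using hC.le_of_ge h1 h2 hy
      rw [hx, map_zero]
      exact Submodule.zero_mem _
    · exact fun x hx => ⟨_, hgN x hx⟩
  let p : J →ₗ[A] N := LinearMap.codRestrict N (g ∘ₗ C.mkQ) fun x => hgr ⟨_, rfl⟩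
  have hp : ∀ x : N, p x = x := fun x => Subtype.ext (hgN x x.2)
  refine ⟨ModuleCat.of A N, LinearMap.codRestrict N f fun x => hN.prop.1 ⟨x, rfl⟩, ?_, ?_, ?_⟩
  · refine ⟨fun Y Z _ _ _ _ a ha b => ?_⟩
    obtain ⟨h, hh⟩ := hJ.out a ha (N.subtype ∘ₗ b)
    exact ⟨p ∘ₗ h, fun x => by
      rw [LinearMap.comp_apply, hh x]
      exact hp (b x)⟩
  · exact fun x y hxy => hf (congrArg Subtype.val hxy)
  · intro K hK
    have h1 : K.map N.subtype = ⊥ := by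
      refine hN.prop.2 _ (Submodule.map_subtype_le N K) (eq_bot_iff.2 ?_)
      rintro _ ⟨⟨k, hk, rfl⟩, x, hx⟩
      have : k ∈ K ⊓ LinearMap.range (LinearMap.codRestrict N f fun x => hN.prop.1 ⟨x, rfl⟩) :=
        ⟨hk, x, Subtype.ext hx⟩
      have h0 : k ∈ (⊥ : Submodule A N) := hK ▸ this
      rw [(Submodule.mem_bot A).1 h0]
      simp
    exact Submodule.map_injective_of_injective N.injective_subtype (by rw [h1, Submodule.map_bot])

/-- The injective envelope `E(X)`. -/
noncomputable def injectiveEnvelope (A : Type u) [Ring A] (X : Type u) [AddCommGroup X]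
    [Module A X] : ModuleCat.{u} A :=
  (exists_isInjectiveEnvelope (A := A) X).choose

/-- The embedding `X → E(X)`. -/
noncomputable def toInjectiveEnvelope (A : Type u) [Ring A] (X : Type u) [AddCommGroup X]
    [Module A X] : X →ₗ[A] injectiveEnvelope A X :=
  (exists_isInjectiveEnvelope (A := A) X).choose_spec.choose

theorem isInjectiveEnvelope_toInjectiveEnvelope (X : Type u) [AddCommGroup X] [Module A X] :
    IsInjectiveEnvelope (toInjectiveEnvelope A X) :=
  (exists_isInjectiveEnvelope (A := A) X).choose_spec.choose_spec

end InjectiveEnvelope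

/-! ### Modules of quotients -/

namespace IdealFilter

variable {A : Type u} [Ring A] (F : IdealFilter A) [F.IsGabriel]

/-- The torsion submodule of `M`; it is the largest torsion submodule, see
`isGreatest_torsionSubmodule`. -/
def torsionSubmodule (M : Type u) [AddCommGroup M] [Module A M] : Submodule A M where
  carrier := {m | F.IsTorsionElem m}
  zero_mem' := by
    obtain ⟨L, hL⟩ := F.nonempty
    exact ⟨L, hL, fun a _ => smul_zero a⟩
  add_mem' := by
    rintro x y ⟨L, hL, hx⟩ ⟨L', hL', hy⟩
    exact ⟨L ⊓ L', Order.PFilter.inf_mem hL hL', fun a ha => by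
      rw [smul_add, hx a ha.1, hy a ha.2, add_zero]⟩
  smul_mem' := by
    rintro b x ⟨L, hL, hx⟩
    exact ⟨L.colon {b}, IsUniform.colon_mem hL b, fun a ha => by
      rw [smul_smul]; exact hx _ (Submodule.mem_colon_singleton.1 ha)⟩

theorem isGreatest_torsionSubmodule (M : Type u) [AddCommGroup M] [Module A M] :
    IsGreatest {N : Submodule A M | F.IsTorsion N} (F.torsionSubmodule M) := by
  refine ⟨?_, ?_⟩
  · rintro ⟨m, L, hL, hm⟩
    exact ⟨L, hL, fun a ha => Subtype.ext (hm a ha)⟩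
  · intro N hN m hm
    obtain ⟨L, hL, h⟩ := hN ⟨m, hm⟩
    exact ⟨L, hL, fun a ha => congrArg Subtype.val (h a ha)⟩

/-- The closure of a submodule `N` of `E`: the largest submodule `K` of `E` containing `N` such
that `K / N` is torsion, see `isGreatest_closure`. -/
def closure {E : Type u} [AddCommGroup E] [Module A E] (N : Submodule A E) : Submodule A E where
  carrier := {x | N.colon {x} ∈ F}
  zero_mem' := by
    obtain ⟨L, hL⟩ := F.nonempty
    exact Order.PFilter.mem_of_le (fun a _ => by simp) hL
  add_mem' := by
    intro x y hx hy
    refine Order.PFilter.mem_of_le (fun a ha => ?_) (Order.PFilter.inf_mem hx hy)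
    have h1 := Submodule.mem_colon_singleton.1 ha.1
    have h2 := Submodule.mem_colon_singleton.1 ha.2
    refine Submodule.mem_colon_singleton.2 ?_
    rw [smul_add]
    exact N.add_mem h1 h2
  smul_mem' := by
    intro b x hx
    refine Order.PFilter.mem_of_le (fun a ha => ?_) (IsUniform.colon_mem hx b)
    have h1 := Submodule.mem_colon_singleton.1 (Submodule.mem_colon_singleton.1 ha)
    refine Submodule.mem_colon_singleton.2 ?_
    rwa [smul_smul]

theorem le_closure {E : Type u} [AddCommGroup E] [Module A E] (N : Submodule A E) :
    N ≤ F.closure N := by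
  intro x hx
  obtain ⟨L, hL⟩ := F.nonempty
  exact Order.PFilter.mem_of_le
    (fun a _ => Submodule.mem_colon_singleton.2 (N.smul_mem a hx)) hL

theorem isGreatest_closure {E : Type u} [AddCommGroup E] [Module A E] (N : Submodule A E) :
    IsGreatest {K : Submodule A E | N ≤ K ∧ F.IsTorsion (K ⧸ N.comap K.subtype)}
      (F.closure N) := by
  refine ⟨⟨F.le_closure N, ?_⟩, ?_⟩
  · intro y
    obtain ⟨⟨x, hx⟩, rfl⟩ := Submodule.Quotient.mk_surjective _ y
    refine ⟨N.colon {x}, hx, fun a ha => ?_⟩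
    rw [← Submodule.Quotient.mk_smul, Submodule.Quotient.mk_eq_zero]
    have h1 : a • x ∈ N := Submodule.mem_colon_singleton.1 ha
    exact h1
  · rintro K ⟨-, hK⟩ x hx
    obtain ⟨L, hL, h⟩ := hK (Submodule.Quotient.mk ⟨x, hx⟩)
    refine Order.PFilter.mem_of_le (fun a ha => ?_) hL
    have h1 := h a ha
    rw [← Submodule.Quotient.mk_smul, Submodule.Quotient.mk_eq_zero] at h1
    exact Submodule.mem_colon_singleton.2 h1

/-- The module of quotients `M_F`: the closure of `M / T(M)` in its injective envelope
`E(M / T(M))`. -/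
noncomputable def moduleOfQuotients (M : Type u) [AddCommGroup M] [Module A M] :
    Submodule A (injectiveEnvelope A (M ⧸ F.torsionSubmodule M)) :=
  F.closure (LinearMap.range (toInjectiveEnvelope A (M ⧸ F.torsionSubmodule M)))

/-- The canonical map `q_M : M → M_F`, the composite `M → M / T(M) → M_F`. -/
noncomputable def toModuleOfQuotients (M : Type u) [AddCommGroup M] [Module A M] :
    M →ₗ[A] F.moduleOfQuotients M :=
  LinearMap.codRestrict _ (toInjectiveEnvelope A (M ⧸ F.torsionSubmodule M))
    (fun x => F.le_closure _ (LinearMap.mem_range_self _ x)) ∘ₗ (F.torsionSubmodule M).mkQ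

end IdealFilter

/-! ### Higher derivations -/

/-- A higher derivation on a ring `R`. -/
structure HigherDerivation (R : Type u) [Ring R] where
  δ : ℕ → R →+ R
  δ_zero : δ 0 = AddMonoidHom.id R
  leibniz : ∀ (n : ℕ) (r s : R),
    δ n (r * s) = ∑ i ∈ Finset.range (n + 1), δ i r * δ (n - i) s

/-- A family of additive maps `d n` on a right `R`-module `M` is a `Δ`-higher derivation.
Here `m <• r` is the right action of `r` on `m`. -/
structure HigherDerivation.IsModuleHD {R : Type u} [Ring R] (Δ : HigherDerivation R)
    {M : Type u} [AddCommGroup M] [Module Rᵐᵒᵖ M] (d : ℕ → M →+ M) : Prop where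
  zero : d 0 = AddMonoidHom.id M
  leibniz : ∀ (n : ℕ) (m : M) (r : R),
    d n (m <• r) = ∑ i ∈ Finset.range (n + 1), d i m <• Δ.δ (n - i) r

/-!
A higher derivation on `N` is the same thing as a linear section `D : N → N⟦x⟧` of the constant
coefficient, where `r` acts on `N⟦x⟧` as right multiplication by `∑ δₙ(r) xⁿ`; namely
`D m = ∑ dₙ(m) xⁿ`. If `N` is closed with respect to a filter `F` of ideals, then so is `N⟦x⟧`: its
`x`-adic filtration has successive quotients `N`, and it is complete. As linear maps into a closed
module extend uniquely along every map with torsion kernel and cokernel, the map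
`m ↦ ∑ q(dₙ(m)) xⁿ` extends uniquely along `q : M → N`. Its constant coefficient extends `q`, and is
therefore the identity of `N`. The module of quotients is closed because it is saturated in an
injective module, which is torsion-free as an essential extension of `M / T(M)`.
-/

/-! ### Closed modules -/

section FilterClosed

variable {A : Type*} [Ring A] (F : IdealFilter A) {M N P Q : Type*}
  [AddCommGroup M] [Module A M] [AddCommGroup N] [Module A N]
  [AddCommGroup P] [Module A P] [AddCommGroup Q] [Module A Q]

/-- A module is torsion-free with respect to a filter `F` of ideals if `0` is its only `F`-torsion
element. -/
def IsFilterTorsionFree (P : Type*) [AddCommGroup P] [Module A P] : Prop :=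
  ∀ p : P, F.IsTorsionElem p → p = 0

/-- A module `P` is closed with respect to a filter `F` of ideals if every linear map `I → P` with
`I ∈ F` extends uniquely to `A`. The extension is encoded by its value `p` at `1`, and its
uniqueness by torsion-freeness. -/
structure IsFilterClosed (P : Type*) [AddCommGroup P] [Module A P] : Prop where
  isFilterTorsionFree : IsFilterTorsionFree F P
  exists_eq_smul : ∀ I ∈ F, ∀ f : I →ₗ[A] P, ∃ p : P, ∀ a : I, f a = (a : A) • p

variable {F}

lemma isTorsionElem_map (f : M →ₗ[A] N) {m : M} (hm : F.IsTorsionElem m) :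
    F.IsTorsionElem (f m) := by
  obtain ⟨L, hL, h⟩ := hm
  exact ⟨L, hL, fun a ha => by rw [← map_smul, h a ha, map_zero]⟩

lemma isTorsionElem_iff_ker_toSpanSingleton_mem {m : M} :
    F.IsTorsionElem m ↔ LinearMap.ker (LinearMap.toSpanSingleton A M m) ∈ F :=
  ⟨fun ⟨_, hL, h⟩ => Order.PFilter.mem_of_le h hL, fun h => ⟨_, h, fun _ ha => ha⟩⟩

lemma isTorsionElem_mkQ_iff {K : Submodule A M} {m : M} :
    F.IsTorsionElem (K.mkQ m) ↔ K.colon {m} ∈ F := by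
  have hker : LinearMap.ker (LinearMap.toSpanSingleton A (M ⧸ K) (K.mkQ m)) = K.colon {m} := by
    ext a
    rw [LinearMap.mem_ker, LinearMap.toSpanSingleton_apply, ← map_smul, ← LinearMap.mem_ker,
      Submodule.ker_mkQ, Submodule.mem_colon_singleton]
  rw [isTorsionElem_iff_ker_toSpanSingleton_mem, hker]

lemma isTorsionElem_of_forall_smul [F.IsGabriel] {L : Ideal A} (hL : L ∈ F) {m : M}
    (h : ∀ a ∈ L, F.IsTorsionElem (a • m)) : F.IsTorsionElem m := by
  refine isTorsionElem_iff_ker_toSpanSingleton_mem.2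
    (IdealFilter.IsGabriel.gabriel_closed _ ⟨L, hL, fun a ha => ?_⟩)
  obtain ⟨K, hK, hKa⟩ := h a ha
  refine Order.PFilter.mem_of_le (fun b hb => Submodule.mem_colon_singleton.2 ?_) hK
  rw [LinearMap.mem_ker, LinearMap.toSpanSingleton_apply, smul_assoc, hKa b hb]

namespace IsFilterTorsionFree

lemma eq_of_forall_smul_eq (hP : IsFilterTorsionFree F P) {I : Ideal A} (hI : I ∈ F) {p p' : P}
    (h : ∀ a ∈ I, a • p = a • p') : p = p' :=
  sub_eq_zero.1 <| hP _ ⟨I, hI, fun a ha => by rw [smul_sub, h a ha, sub_self]⟩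

lemma linearMap_eq_zero (hP : IsFilterTorsionFree F P) (hM : F.IsTorsion M) (f : M →ₗ[A] P) :
    f = 0 :=
  LinearMap.ext fun m => hP _ (isTorsionElem_map f (hM m))

lemma linearMap_ext (hP : IsFilterTorsionFree F P) {q : M →ₗ[A] Q}
    (hcoker : F.IsTorsion (Q ⧸ LinearMap.range q)) {f g : Q →ₗ[A] P} (h : f ∘ₗ q = g ∘ₗ q) :
    f = g := by
  have hle : LinearMap.range q ≤ LinearMap.ker (f - g) := by
    rw [LinearMap.range_le_ker_iff, LinearMap.sub_comp, h, sub_self]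
  rw [← sub_eq_zero, ← Submodule.liftQ_mkQ _ (f - g) hle,
    hP.linearMap_eq_zero hcoker ((LinearMap.range q).liftQ (f - g) hle), LinearMap.zero_comp]

lemma ker_le_ker (hP : IsFilterTorsionFree F P) {q : M →ₗ[A] Q}
    (hker : F.IsTorsion (LinearMap.ker q)) (f : M →ₗ[A] P) :
    LinearMap.ker q ≤ LinearMap.ker f := fun m hm =>
  LinearMap.congr_fun (hP.linearMap_eq_zero hker (f.domRestrict _)) ⟨m, hm⟩

end IsFilterTorsionFree

namespace IsFilterClosed

theorem exists_comp_subtype_eq (hP : IsFilterClosed F P) {K : Submodule A Q}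
    (hK : F.IsTorsion (Q ⧸ K)) (g : K →ₗ[A] P) : ∃ g' : Q →ₗ[A] P, g' ∘ₗ K.subtype = g := by
  have hcolon (x : Q) : K.colon {x} ∈ F := isTorsionElem_mkQ_iff.1 (hK _)
  have hex (x : Q) : ∃ p : P, ∀ (a : A) (ha : a • x ∈ K), g ⟨a • x, ha⟩ = a • p := by
    let smulx : K.colon {x} →ₗ[A] K := (LinearMap.toSpanSingleton A Q x).restrict
      fun _ => Submodule.mem_colon_singleton.1
    obtain ⟨p, hp⟩ := hP.exists_eq_smul _ (hcolon x) (g ∘ₗ smulx)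
    exact ⟨p, fun a ha => hp ⟨a, Submodule.mem_colon_singleton.2 ha⟩⟩
  choose E hE using hex
  have map_add (x y : Q) : E (x + y) = E x + E y := by
    refine hP.isFilterTorsionFree.eq_of_forall_smul_eq
      (Order.PFilter.inf_mem (hcolon x) (hcolon y)) fun a ⟨hx, hy⟩ => ?_
    rw [SetLike.mem_coe, Submodule.mem_colon_singleton] at hx hy
    rw [smul_add, ← hE x a hx, ← hE y a hy, ← map_add,
      ← hE (x + y) a (by rw [smul_add]; exact K.add_mem hx hy)]
    exact congrArg g (Subtype.ext (smul_add a x y))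
  have map_smul (b : A) (x : Q) : E (b • x) = b • E x := by
    refine hP.isFilterTorsionFree.eq_of_forall_smul_eq (hcolon (b • x)) fun a ha => ?_
    rw [Submodule.mem_colon_singleton] at ha
    have hab : (a * b) • x ∈ K := by rwa [mul_smul]
    calc a • E (b • x) = g ⟨a • b • x, ha⟩ := (hE (b • x) a ha).symm
      _ = g ⟨(a * b) • x, hab⟩ := congrArg g (Subtype.ext (smul_smul a b x))
      _ = a • b • E x := by rw [hE, mul_smul]
  refine ⟨{ toFun := E, map_add' := map_add, map_smul' := map_smul }, LinearMap.ext fun y => ?_⟩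
  have hy := hE y 1 (by rw [one_smul]; exact y.2)
  simp only [one_smul] at hy
  exact hy.symm

theorem existsUnique_comp_eq (hP : IsFilterClosed F P) {q : M →ₗ[A] Q}
    (hker : F.IsTorsion (LinearMap.ker q)) (hcoker : F.IsTorsion (Q ⧸ LinearMap.range q))
    (f : M →ₗ[A] P) : ∃! f' : Q →ₗ[A] P, f' ∘ₗ q = f := by
  let onRange : LinearMap.range q →ₗ[A] P :=
    (LinearMap.ker q).liftQ f (hP.isFilterTorsionFree.ker_le_ker hker f) ∘ₗ
      q.quotKerEquivRange.symm.toLinearMap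
  obtain ⟨f', hf'⟩ := hP.exists_comp_subtype_eq hcoker onRange
  have hf'q : f' ∘ₗ q = f := by
    ext m
    calc f' (q m) = onRange ⟨q m, q.mem_range_self m⟩ := LinearMap.congr_fun hf' ⟨q m, _⟩
      _ = f m := by
        simp only [onRange, LinearMap.comp_apply, LinearEquiv.coe_coe,
          LinearMap.quotKerEquivRange_symm_apply_image, Submodule.mkQ_apply,
          Submodule.liftQ_apply]
  exact ⟨f', hf'q, fun g hg => hP.isFilterTorsionFree.linearMap_ext hcoker (hg.trans hf'q.symm)⟩

end IsFilterClosed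

end FilterClosed

/-! ### The module of quotients is closed -/

section ModuleOfQuotients

variable {A : Type u} [Ring A] {F : IdealFilter A} [F.IsGabriel] {E X : Type u}
  [AddCommGroup E] [Module A E] [AddCommGroup X] [Module A X]

lemma mem_filterClosure_of_forall_smul_mem {N : Submodule A E} {L : Ideal A} (hL : L ∈ F) {x : E}
    (h : ∀ a ∈ L, a • x ∈ F.closure N) : x ∈ F.closure N := by
  refine isTorsionElem_mkQ_iff.1 (isTorsionElem_of_forall_smul hL fun a ha => ?_)
  rw [← map_smul]
  exact isTorsionElem_mkQ_iff.2 (h a ha)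

theorem IsFilterTorsionFree.isFilterClosed_closure (hE : IsFilterTorsionFree F E)
    (hinj : Module.Injective A E) (N : Submodule A E) : IsFilterClosed F (F.closure N) where
  isFilterTorsionFree x hx := Subtype.ext (hE x (isTorsionElem_map (F.closure N).subtype hx))
  exists_eq_smul I hI f := by
    obtain ⟨g, hg⟩ := hinj.out I.subtype I.injective_subtype ((F.closure N).subtype ∘ₗ f)
    have hsmul (a : I) : (f a : E) = (a : A) • g 1 := by
      rw [← map_smul, smul_eq_mul, mul_one]
      exact (hg a).symm
    have hmem : g 1 ∈ F.closure N :=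
      mem_filterClosure_of_forall_smul_mem hI fun a ha => hsmul ⟨a, ha⟩ ▸ (f ⟨a, ha⟩).2
    exact ⟨⟨g 1, hmem⟩, fun a => Subtype.ext (hsmul a)⟩

lemma isFilterTorsionFree_quotient_torsionSubmodule :
    IsFilterTorsionFree F (X ⧸ F.torsionSubmodule X) := by
  intro y hy
  obtain ⟨x, rfl⟩ := Submodule.mkQ_surjective _ y
  obtain ⟨L, hL, h⟩ := hy
  refine (Submodule.Quotient.mk_eq_zero _).2 (isTorsionElem_of_forall_smul hL fun a ha => ?_)
  exact (Submodule.Quotient.mk_eq_zero _).1 ((map_smul _ a x).trans (h a ha))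

lemma IsInjectiveEnvelope.isFilterTorsionFree {i : X →ₗ[A] E} (hi : IsInjectiveEnvelope i)
    (hX : IsFilterTorsionFree F X) : IsFilterTorsionFree F E := by
  have hbot : F.torsionSubmodule E = ⊥ := by
    refine hi.essential _ (eq_bot_iff.2 ?_)
    rintro _ ⟨⟨L, hL, h⟩, x, rfl⟩
    have hx : x = 0 := hX x ⟨L, hL, fun a ha => hi.injective (by rw [map_smul, h a ha, map_zero])⟩
    rw [hx, map_zero]
    exact Submodule.zero_mem _
  intro e he
  rwa [← Submodule.mem_bot A, ← hbot]

variable (F X)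

theorem isFilterClosed_moduleOfQuotients : IsFilterClosed F (F.moduleOfQuotients X) :=
  have hE := isInjectiveEnvelope_toInjectiveEnvelope (A := A) (X ⧸ F.torsionSubmodule X)
  (hE.isFilterTorsionFree isFilterTorsionFree_quotient_torsionSubmodule).isFilterClosed_closure
    hE.injective_module _

lemma ker_toModuleOfQuotients : LinearMap.ker (F.toModuleOfQuotients X) = F.torsionSubmodule X := by
  ext x
  rw [LinearMap.mem_ker, Subtype.ext_iff, ← Submodule.Quotient.mk_eq_zero (F.torsionSubmodule X)]
  exact map_eq_zero_iff _ (isInjectiveEnvelope_toInjectiveEnvelope _).injective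

lemma range_toModuleOfQuotients : LinearMap.range (F.toModuleOfQuotients X) =
    (LinearMap.range (toInjectiveEnvelope A (X ⧸ F.torsionSubmodule X))).comap
      (F.moduleOfQuotients X).subtype := by
  ext y
  constructor
  · rintro ⟨x, rfl⟩
    exact ⟨_, rfl⟩
  · rintro ⟨z, hz⟩
    obtain ⟨x, rfl⟩ := Submodule.mkQ_surjective _ z
    exact ⟨x, Subtype.ext hz⟩

lemma isTorsion_ker_toModuleOfQuotients :
    F.IsTorsion (LinearMap.ker (F.toModuleOfQuotients X)) := by
  rw [ker_toModuleOfQuotients]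
  exact (F.isGreatest_torsionSubmodule X).1

lemma isTorsion_coker_toModuleOfQuotients :
    F.IsTorsion (F.moduleOfQuotients X ⧸ LinearMap.range (F.toModuleOfQuotients X)) := by
  rw [range_toModuleOfQuotients]
  exact (F.isGreatest_closure _).1.2

end ModuleOfQuotients

/-! ### Twisted power series -/

namespace HigherDerivation

open Finset MulOpposite

variable {R : Type u} [Ring R] (Δ : HigherDerivation R)

lemma δ_zero_apply (r : R) : Δ.δ 0 r = r := by rw [Δ.δ_zero, AddMonoidHom.id_apply]

lemma δ_one {n : ℕ} (hn : n ≠ 0) : Δ.δ n 1 = 0 := by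
  induction n using Nat.strong_induction_on with
  | _ n ih =>
    obtain ⟨n, rfl⟩ := Nat.exists_eq_succ_of_ne_zero hn
    have hmiddle : ∑ i ∈ range n, Δ.δ (i + 1) 1 * Δ.δ (n + 1 - (i + 1)) 1 = 0 :=
      sum_eq_zero fun i hi => by
        rw [ih _ (Nat.succ_lt_succ (mem_range.1 hi)) i.succ_ne_zero, zero_mul]
    have h := Δ.leibniz (n + 1) 1 1
    rw [sum_range_succ, sum_range_succ', hmiddle, Nat.sub_self, Nat.sub_zero, Δ.δ_zero_apply,
      mul_one, mul_one, one_mul, zero_add] at h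
    exact left_eq_add.1 h

/-- Power series `∑ mₙ xⁿ` with coefficients in a right `R`-module `N`, on which `r : R` acts as
right multiplication by `∑ δₙ(r) xⁿ`. The phantom argument `Δ` selects this action. -/
@[nolint unusedArguments]
def TwistedSeries (_ : HigherDerivation R) (N : Type*) := ℕ → N

namespace TwistedSeries

variable {Δ} {N : Type*} [AddCommGroup N]

instance : AddCommGroup (Δ.TwistedSeries N) := inferInstanceAs (AddCommGroup (ℕ → N))

/-- The power series with prescribed coefficients. -/
def mk (p : ℕ → N) : Δ.TwistedSeries N := p

/-- The coefficient of `xⁿ`. -/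
def coeff (n : ℕ) : Δ.TwistedSeries N →+ N := Pi.evalAddMonoidHom (fun _ : ℕ => N) n

@[simp] lemma coeff_mk (p : ℕ → N) (n : ℕ) : coeff n (mk p : Δ.TwistedSeries N) = p n := rfl

@[ext] lemma ext {p p' : Δ.TwistedSeries N} (h : ∀ n, coeff n p = coeff n p') : p = p' := funext h

variable [Module Rᵐᵒᵖ N]

instance : SMul Rᵐᵒᵖ (Δ.TwistedSeries N) where
  smul a p := mk fun n => ∑ i ∈ range (n + 1), coeff i p <• Δ.δ (n - i) a.unop

lemma coeff_smul (n : ℕ) (a : Rᵐᵒᵖ) (p : Δ.TwistedSeries N) :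
    coeff n (a • p) = ∑ i ∈ range (n + 1), coeff i p <• Δ.δ (n - i) a.unop := rfl

lemma coeff_one_smul (n : ℕ) (p : Δ.TwistedSeries N) :
    coeff n ((1 : Rᵐᵒᵖ) • p) = coeff n p := by
  have hlower : ∑ i ∈ range n, coeff i p <• Δ.δ (n - i) 1 = 0 := sum_eq_zero fun i hi => by
    rw [Δ.δ_one (Nat.sub_ne_zero_of_lt (mem_range.1 hi)), op_zero, zero_smul]
  rw [coeff_smul, unop_one, sum_range_succ, hlower, zero_add, Nat.sub_self, δ_zero_apply, op_one,
    one_smul]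

lemma coeff_mul_smul (n : ℕ) (a b : Rᵐᵒᵖ) (p : Δ.TwistedSeries N) :
    coeff n ((a * b) • p) = coeff n (a • b • p) := by
  let term (i j : ℕ) : N := (coeff i p <• Δ.δ j b.unop) <• Δ.δ (n - (i + j)) a.unop
  calc coeff n ((a * b) • p)
      = ∑ i ∈ range (n + 1), ∑ j ∈ range (n + 1 - i), term i j := by
        rw [coeff_smul]
        refine sum_congr rfl fun i hi => ?_
        rw [unop_mul, Δ.leibniz, op_sum, sum_smul, Nat.sub_add_comm (mem_range_succ_iff.1 hi)]
        simp only [term, op_mul, mul_smul, Nat.sub_sub]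
    _ = ∑ k ∈ range (n + 1), ∑ i ∈ range (k + 1), term i (k - i) :=
        (sum_range_diag_flip (n + 1) term).symm
    _ = coeff n (a • b • p) := by
        rw [coeff_smul]
        refine sum_congr rfl fun k _ => ?_
        rw [coeff_smul, smul_sum]
        refine sum_congr rfl fun i hi => ?_
        simp only [term, Nat.add_sub_cancel' (mem_range_succ_iff.1 hi)]

instance : Module Rᵐᵒᵖ (Δ.TwistedSeries N) where
  one_smul p := ext fun n => coeff_one_smul n p
  mul_smul a b p := ext fun n => coeff_mul_smul n a b p
  smul_zero a := by ext n; simp only [coeff_smul, map_zero, smul_zero, sum_const_zero]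
  smul_add a p p' := by ext n; simp only [coeff_smul, map_add, smul_add, sum_add_distrib]
  add_smul a b p := by
    ext n; simp only [coeff_smul, map_add, unop_add, op_add, add_smul, sum_add_distrib]
  zero_smul p := by
    ext n; simp only [coeff_smul, unop_zero, map_zero, op_zero, zero_smul, sum_const_zero]

/-- The series without terms of degree less than `n`: the steps of the `x`-adic filtration. -/
def vanishingBelow (Δ : HigherDerivation R) (N : Type*) [AddCommGroup N] [Module Rᵐᵒᵖ N] (n : ℕ) :
    Submodule Rᵐᵒᵖ (Δ.TwistedSeries N) where
  carrier := {p | ∀ k < n, coeff k p = 0}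
  zero_mem' k _ := map_zero (coeff k)
  add_mem' hp hp' k hk := by rw [map_add, hp k hk, hp' k hk, add_zero]
  smul_mem' a p hp k hk := by
    rw [coeff_smul]
    refine sum_eq_zero fun i hi => ?_
    rw [hp i ((mem_range_succ_iff.1 hi).trans_lt hk), smul_zero]

lemma mem_vanishingBelow {n : ℕ} {p : Δ.TwistedSeries N} :
    p ∈ vanishingBelow Δ N n ↔ ∀ k < n, coeff k p = 0 := Iff.rfl

lemma mem_vanishingBelow_zero (p : Δ.TwistedSeries N) : p ∈ vanishingBelow Δ N 0 :=
  fun k hk => absurd hk k.not_lt_zero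

lemma mem_vanishingBelow_succ {n : ℕ} {p : Δ.TwistedSeries N} :
    p ∈ vanishingBelow Δ N (n + 1) ↔ p ∈ vanishingBelow Δ N n ∧ coeff n p = 0 := by
  simp only [mem_vanishingBelow, Nat.forall_lt_succ_right]

lemma vanishingBelow_antitone : Antitone (vanishingBelow Δ N) :=
  fun _ _ hmn _ hp k hk => hp k (hk.trans_le hmn)

lemma eq_zero_of_forall_mem_vanishingBelow {p : Δ.TwistedSeries N}
    (h : ∀ n, p ∈ vanishingBelow Δ N n) : p = 0 :=
  ext fun n => (h (n + 1) n n.lt_succ_self).trans (map_zero (coeff n)).symm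

lemma coeff_smul_of_mem_vanishingBelow {n : ℕ} {p : Δ.TwistedSeries N}
    (hp : p ∈ vanishingBelow Δ N n) (a : Rᵐᵒᵖ) : coeff n (a • p) = a • coeff n p := by
  have hlower : ∑ i ∈ range n, coeff i p <• Δ.δ (n - i) a.unop = 0 := sum_eq_zero fun i hi => by
    rw [hp i (mem_range.1 hi), smul_zero]
  rw [coeff_smul, sum_range_succ, hlower, zero_add, Nat.sub_self, δ_zero_apply, op_unop]

/-- The coefficient of `xⁿ` as a linear map on the series without lower terms; on arbitrary series
it is only additive. -/
def leadingCoeff (n : ℕ) : vanishingBelow Δ N n →ₗ[Rᵐᵒᵖ] N where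
  toFun p := coeff n p.1
  map_add' p p' := map_add (coeff n) p.1 p'.1
  map_smul' a p := coeff_smul_of_mem_vanishingBelow p.2 a

/-- The constant coefficient as a linear map. -/
def constCoeff : Δ.TwistedSeries N →ₗ[Rᵐᵒᵖ] N where
  toFun := coeff 0
  map_add' := map_add (coeff 0)
  map_smul' a p := coeff_smul_of_mem_vanishingBelow (mem_vanishingBelow_zero p) a

variable {F : IdealFilter Rᵐᵒᵖ}

lemma mem_vanishingBelow_of_forall_smul_mem (hN : IsFilterTorsionFree F N) {I : Ideal Rᵐᵒᵖ}
    (hI : I ∈ F) {p : Δ.TwistedSeries N} {n : ℕ} (h : ∀ a ∈ I, a • p ∈ vanishingBelow Δ N n) :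
    p ∈ vanishingBelow Δ N n := by
  induction n with
  | zero => exact mem_vanishingBelow_zero p
  | succ n ih =>
    have hp : p ∈ vanishingBelow Δ N n := ih fun a ha => (mem_vanishingBelow_succ.1 (h a ha)).1
    refine mem_vanishingBelow_succ.2 ⟨hp, hN _ ⟨I, hI, fun a ha => ?_⟩⟩
    rw [← coeff_smul_of_mem_vanishingBelow hp]
    exact (mem_vanishingBelow_succ.1 (h a ha)).2

lemma exists_sub_smul_mem_vanishingBelow (hN : IsFilterClosed F N) {I : Ideal Rᵐᵒᵖ} (hI : I ∈ F)
    (f : I →ₗ[Rᵐᵒᵖ] Δ.TwistedSeries N) (n : ℕ) :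
    ∃ p : Δ.TwistedSeries N, ∀ a : I, f a - (a : Rᵐᵒᵖ) • p ∈ vanishingBelow Δ N n := by
  induction n with
  | zero => exact ⟨0, fun a => mem_vanishingBelow_zero _⟩
  | succ n ih =>
    obtain ⟨p, hp⟩ := ih
    let remainder : I →ₗ[Rᵐᵒᵖ] vanishingBelow Δ N n :=
      (f - (LinearMap.toSpanSingleton Rᵐᵒᵖ _ p).domRestrict I).codRestrict _ hp
    obtain ⟨x, hx⟩ := hN.exists_eq_smul I hI (leadingCoeff n ∘ₗ remainder)
    let monomial : Δ.TwistedSeries N := mk (Pi.single n x)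
    have hmonomial : monomial ∈ vanishingBelow Δ N n := fun k hk => by
      rw [coeff_mk, Pi.single_eq_of_ne hk.ne]
    refine ⟨p + monomial, fun a => ?_⟩
    rw [smul_add, ← sub_sub]
    refine mem_vanishingBelow_succ.2
      ⟨Submodule.sub_mem _ (hp a) (Submodule.smul_mem _ _ hmonomial), ?_⟩
    rw [map_sub, coeff_smul_of_mem_vanishingBelow hmonomial, coeff_mk, Pi.single_eq_same]
    exact sub_eq_zero.2 (hx a)

lemma exists_forall_sub_mem_vanishingBelow {p : ℕ → Δ.TwistedSeries N}
    (hp : ∀ m n, m ≤ n → p n - p m ∈ vanishingBelow Δ N m) :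
    ∃ l : Δ.TwistedSeries N, ∀ n, l - p n ∈ vanishingBelow Δ N n := by
  refine ⟨mk fun k => coeff k (p (k + 1)), fun n k hk => ?_⟩
  rw [map_sub, coeff_mk, ← neg_eq_zero, neg_sub, ← map_sub]
  exact hp (k + 1) n hk k k.lt_succ_self

theorem isFilterClosed (hN : IsFilterClosed F N) : IsFilterClosed F (Δ.TwistedSeries N) where
  isFilterTorsionFree := by
    rintro p ⟨I, hI, h⟩
    refine eq_zero_of_forall_mem_vanishingBelow fun n =>
      mem_vanishingBelow_of_forall_smul_mem hN.isFilterTorsionFree hI fun a ha => ?_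
    rw [h a ha]
    exact Submodule.zero_mem _
  exists_eq_smul I hI f := by
    choose p hp using exists_sub_smul_mem_vanishingBelow hN hI f
    have hcauchy (m n : ℕ) (hmn : m ≤ n) : p n - p m ∈ vanishingBelow Δ N m := by
      refine mem_vanishingBelow_of_forall_smul_mem hN.isFilterTorsionFree hI fun a ha => ?_
      rw [smul_sub, ← sub_sub_sub_cancel_left _ _ (f ⟨a, ha⟩)]
      exact Submodule.sub_mem _ (hp m ⟨a, ha⟩) (vanishingBelow_antitone hmn (hp n ⟨a, ha⟩))
    obtain ⟨l, hl⟩ := exists_forall_sub_mem_vanishingBelow hcauchy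
    refine ⟨l, fun a => sub_eq_zero.1 (eq_zero_of_forall_mem_vanishingBelow fun n => ?_)⟩
    rw [← sub_sub_sub_cancel_right _ _ ((a : Rᵐᵒᵖ) • p n), ← smul_sub]
    exact Submodule.sub_mem _ (hp n a) (Submodule.smul_mem _ _ (hl n))

end TwistedSeries

/-! ### Higher derivations as linear maps into twisted power series -/

variable {Δ} {M N : Type u} [AddCommGroup M] [Module Rᵐᵒᵖ M] [AddCommGroup N] [Module Rᵐᵒᵖ N]

/-- The linear map `m ↦ ∑ f(dₙ(m)) xⁿ` that encodes a higher derivation `d` followed by `f`. -/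
def IsModuleHD.toSeries {d : ℕ → M →+ M} (hd : Δ.IsModuleHD d) (f : M →ₗ[Rᵐᵒᵖ] N) :
    M →ₗ[Rᵐᵒᵖ] Δ.TwistedSeries N where
  toFun m := .mk fun n => f (d n m)
  map_add' m m' := TwistedSeries.ext fun n => by
    simp only [TwistedSeries.coeff_mk, map_add]
  map_smul' a m := TwistedSeries.ext fun n => by
    have h := hd.leibniz n m a.unop
    rw [op_unop] at h
    simp only [TwistedSeries.coeff_mk, TwistedSeries.coeff_smul, RingHom.id_apply, h, map_sum,
      map_smul]

lemma isModuleHD_coeff_comp {D : N →ₗ[Rᵐᵒᵖ] Δ.TwistedSeries N}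
    (hD : TwistedSeries.constCoeff ∘ₗ D = LinearMap.id) :
    Δ.IsModuleHD fun n => (TwistedSeries.coeff n).comp D.toAddMonoidHom where
  zero := AddMonoidHom.ext (LinearMap.congr_fun hD)
  leibniz n x r := congrArg (TwistedSeries.coeff n) (map_smul D (op r) x)

end HigherDerivation

open HigherDerivation TwistedSeries in
theorem mainTheorem3_general {R : Type u} [Ring R] {F : IdealFilter Rᵐᵒᵖ} {Δ : HigherDerivation R}
    {M N : Type u} [AddCommGroup M] [Module Rᵐᵒᵖ M] [AddCommGroup N] [Module Rᵐᵒᵖ N]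
    (hN : IsFilterClosed F N) {q : M →ₗ[Rᵐᵒᵖ] N} (hker : F.IsTorsion (LinearMap.ker q))
    (hcoker : F.IsTorsion (N ⧸ LinearMap.range q)) {d : ℕ → M →+ M} (hd : Δ.IsModuleHD d) :
    ∃! d' : ℕ → N →+ N, Δ.IsModuleHD d' ∧ ∀ (n : ℕ) (m : M), d' n (q m) = q (d n m) := by
  obtain ⟨D, hDq, hD_unique⟩ :=
    (TwistedSeries.isFilterClosed hN).existsUnique_comp_eq hker hcoker (hd.toSeries q)
  have hcoeff (n : ℕ) (m : M) : coeff n (D (q m)) = q (d n m) :=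
    congrArg (coeff n) (LinearMap.congr_fun hDq m)
  have hconst : constCoeff ∘ₗ D = LinearMap.id :=
    hN.isFilterTorsionFree.linearMap_ext hcoker <| LinearMap.ext fun m => by
      change coeff 0 (D (q m)) = q m
      rw [hcoeff, hd.zero, AddMonoidHom.id_apply]
  refine ⟨_, ⟨isModuleHD_coeff_comp hconst, hcoeff⟩, ?_⟩
  rintro d' ⟨hd', hd'q⟩
  have hseries : hd'.toSeries LinearMap.id = D :=
    hD_unique _ <| LinearMap.ext fun m => TwistedSeries.ext fun n => hd'q n m
  funext n
  ext x
  rw [← hseries]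
  rfl

theorem mainTheorem3 {R : Type u} [Ring R] (τ : TorsionTheory Rᵐᵒᵖ) (hτ : τ.IsHereditary)
    (Δ : HigherDerivation R) (M : Type u) [AddCommGroup M] [Module Rᵐᵒᵖ M]
    (d : ℕ → M →+ M) (hd : Δ.IsModuleHD d) :
    ∃! d' : ℕ → (τ.gabrielFilter hτ).moduleOfQuotients M →+
        (τ.gabrielFilter hτ).moduleOfQuotients M,
      Δ.IsModuleHD d' ∧
        ∀ (n : ℕ) (m : M),
          d' n ((τ.gabrielFilter hτ).toModuleOfQuotients M m) =
            (τ.gabrielFilter hτ).toModuleOfQuotients M (d n m) :=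
  mainTheorem3_general (isFilterClosed_moduleOfQuotients _ M)
    (isTorsion_ker_toModuleOfQuotients _ M) (isTorsion_coker_toModuleOfQuotients _ M) hd
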